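/- Let $K=\mathbb{F}_q$ be a finite field, let $s\ge 1$, $n\ge 0$, and let $v_1,\dots,v_s\in\mathbb{N}^n$. For $x\in (K^*)^n$ write $x^{v_i}=x_1^{v_{i1}}\cdots x_n^{v_{in}}$, and similarly $y^{v_i}$ for indeterminates $y_1,\dots,y_n$. Let $$X=\{[(x^{v_1},\dots,x^{v_s})] : x\in (K^*)^n\}\subset\mathbb{P}^{s-1}$$ be the algebraic toric set in projective space over $K$ parameterized by $y^{v_1},\dots,y^{v_s}$. Let $S=K[t_1,\dots,t_s]$ with the standard grading, let $I(X)\subset S$ be the ideal generated by the homogeneous polynomials that vanish on $X$, and let $B=K[t_1,\dots,t_s,y_1,\dots,y_n,z]$, a polynomial ring containing $S$. A binomial of $S$ is a polynomial $t^a-t^b$ with $a,b\in\mathbb{N}^s$; a binomial ideal is an ideal generated by binomials; a lattice ideal is an ideal of the form $(\{t^a-t^b : a,b\in\mathbb{N}^s,\ a-b\in\mathcal{L}\})$ for some additive subgroup $\mathcal{L}\subset\mathbb{Z}^s$. Then: (a) $I(X)=\left(\{t_i-y^{v_i}z\}_{i=1}^s\cup\{y_j^{q-1}-1\}_{j=1}^n\right)\cap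 S$, where the ideal in parentheses is taken in $B$, and $I(X)$ is a binomial ideal. (b) For every $i$, $t_i$ is not a zero divisor on $S/I(X)$, and $I(X)$ is a radical lattice ideal. (c) $S/I(X)$ is a Cohen–Macaulay ring of Krull dimension $1$. -/

import Mathlib

open scoped LinearAlgebra.Projectivization

noncomputable section

namespace ToricSet

/-- The vector `(x^{v_1}, …, x^{v_s}) ∈ K^s` attached to `x ∈ (K^*)^n` and to the exponents
`v_i ∈ ℤ^n`, where `x^{v_i} = x_1^{v_{i1}} ⋯ x_n^{v_{in}}`. -/
def toricPoint {K : Type*} [Field K] {s n : ℕ} (v : Fin s → Fin n → ℤ) (x : Fin n → Kˣ) :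
    Fin s → K :=
  fun i => ∏ j, (x j : K) ^ v i j

/-- The algebraic toric set `X ⊆ ℙ^{s-1}` parameterized by the Laurent monomials `y^{v_i}`. -/
def algebraicToricSet (K : Type*) [Field K] {s n : ℕ} (v : Fin s → Fin n → ℤ) :
    Set (ℙ K (Fin s → K)) :=
  {P | ∃ (x : Fin n → Kˣ) (h : toricPoint v x ≠ 0), P = Projectivization.mk K (toricPoint v x) h}

/-- A polynomial vanishes at a point of projective space if it vanishes at every nonzero vector
representing the point. -/
def VanishesAt {K : Type*} [Field K] {s : ℕ} (f : MvPolynomial (Fin s) K)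
    (P : ℙ K (Fin s → K)) : Prop :=
  ∀ (w : Fin s → K) (hw : w ≠ 0), Projectivization.mk K w hw = P → MvPolynomial.eval w f = 0

/-- The vanishing ideal `I(X)`: the ideal of `S = K[t_1, …, t_s]` generated by the homogeneous
polynomials that vanish at all points of `X`. -/
def vanishingIdeal {K : Type*} [Field K] {s : ℕ} (X : Set (ℙ K (Fin s → K))) :
    Ideal (MvPolynomial (Fin s) K) :=
  Ideal.span {f | (∃ d : ℕ, f.IsHomogeneous d) ∧ ∀ P ∈ X, VanishesAt f P}

/-- A binomial is a polynomial `t^a - t^b` with `a, b ∈ ℕ^s`. -/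
def IsBinomial {K : Type*} [Field K] {s : ℕ} (f : MvPolynomial (Fin s) K) : Prop :=
  ∃ a b : Fin s →₀ ℕ, f = MvPolynomial.monomial a 1 - MvPolynomial.monomial b 1

/-- An ideal generated by binomials. -/
def IsBinomialIdeal {K : Type*} [Field K] {s : ℕ} (I : Ideal (MvPolynomial (Fin s) K)) : Prop :=
  ∃ G : Set (MvPolynomial (Fin s) K), (∀ g ∈ G, IsBinomial g) ∧ I = Ideal.span G

/-- The ideal `I(L) = (t^a - t^b : a, b ∈ ℕ^s, a - b ∈ L)` of a lattice `L ⊆ ℤ^s`. -/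
def latticeIdeal (K : Type*) [Field K] {s : ℕ} (L : AddSubgroup (Fin s → ℤ)) :
    Ideal (MvPolynomial (Fin s) K) :=
  Ideal.span {f | ∃ a b : Fin s →₀ ℕ, (fun i => (a i : ℤ) - (b i : ℤ)) ∈ L ∧
    f = MvPolynomial.monomial a 1 - MvPolynomial.monomial b 1}

/-- An ideal of the form `I(L)` for some additive subgroup `L` of `ℤ^s`. -/
def IsLatticeIdeal {K : Type*} [Field K] {s : ℕ} (I : Ideal (MvPolynomial (Fin s) K)) : Prop :=
  ∃ L : AddSubgroup (Fin s → ℤ), I = latticeIdeal K L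

/-- The set of zero divisors of a `D`-module `M`. -/
def zeroDivisors (D M : Type*) [CommRing D] [AddCommGroup M] [Module D M] : Set D :=
  {r | ∃ m : M, m ≠ 0 ∧ r • m = 0}

/-- The indeterminates of `B = K[t_1, …, t_s, y_1, …, y_n, z]`. -/
inductive BVar (s n : ℕ) : Type
  | t (i : Fin s) : BVar s n
  | y (j : Fin n) : BVar s n
  | z : BVar s n

/-- The ideal `(t_i - y^{v_i} z, y_j^{q-1} - 1)` of `B`, where `v_i ∈ ℕ^n` and `q = |K|`. -/
def parametrizationIdeal (K : Type*) [Field K] [Fintype K] {s n : ℕ} (v : Fin s → Fin n → ℕ) :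
    Ideal (MvPolynomial (BVar s n) K) :=
  Ideal.span
    (Set.range (fun i : Fin s =>
        (MvPolynomial.X (BVar.t i) -
          (∏ j, MvPolynomial.X (BVar.y j) ^ v i j) * MvPolynomial.X BVar.z :
            MvPolynomial (BVar s n) K)) ∪
      Set.range (fun j : Fin n =>
        (MvPolynomial.X (BVar.y j) ^ (Fintype.card K - 1) - 1 : MvPolynomial (BVar s n) K)))

/-- The inclusion `S = K[t_1, …, t_s] ⊆ B`. -/
def inclusionB (K : Type*) [Field K] (s n : ℕ) :
    MvPolynomial (Fin s) K →+* MvPolynomial (BVar s n) K :=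
  (MvPolynomial.rename (BVar.t : Fin s → BVar s n)).toRingHom

/-- The depth of a local ring: the supremum of the lengths of the regular sequences contained in
the maximal ideal. -/
def localDepth (R : Type*) [CommRing R] [IsLocalRing R] : ℕ∞ :=
  ⨆ rs ∈ {rs : List R | (∀ r ∈ rs, r ∈ IsLocalRing.maximalIdeal R) ∧
    RingTheory.Sequence.IsRegular R rs}, (rs.length : ℕ∞)

/-- A Noetherian ring is Cohen–Macaulay if each of its localizations at a maximal ideal
has depth equal to its Krull dimension. -/
def IsCohenMacaulay (R : Type*) [CommRing R] : Prop :=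
  IsNoetherianRing R ∧ ∀ (m : Ideal R) [m.IsMaximal],
    ((localDepth (Localization.AtPrime m) : ℕ∞) : WithBot ℕ∞) =
      ringKrullDim (Localization.AtPrime m)

end ToricSet

end

/-!
Write `S = K[t_1, …, t_s]` and `q = |K|`. For `x ∈ (K^*)^n` let `φ_x : S → K[z]` be the
homomorphism `t_i ↦ x^{v_i} z`, the restriction of polynomials to the line represented by the point
of `X` with parameter `x`. Let `L ⊆ ℤ^s` be the lattice of the `c` with `∑ c_i = 0` and
`∑ c_i v_i ≡ 0 mod q - 1`. Four ideals are shown to coincide by the cycle of inclusions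

`I(X) ⊆ I(L) ⊆ (t_i - y^{v_i} z, y_j^{q-1} - 1) ∩ S ⊆ ⋂_x ker φ_x ⊆ I(X)`.

* For the first inclusion (`vanishingIdeal_le_latticeIdeal`), a homogeneous `f = ∑ c_a t^a` that
  vanishes on `X` is a linear relation between the characters `x ↦ ∏ (x^{v_i})^{a_i}` of the torus
  `(K^*)^n`. Distinct characters are linearly independent, so the coefficients `c_a` with a given
  character add up to zero; and two monomials of the same degree with the same character are
  congruent modulo `I(L)`, because `K^*` is cyclic of order `q - 1`.
* The second (`latticeIdeal_relationLattice_le_comap`) holds since `y_j^{q-1} = 1` allows the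
  exponents of `y_j` to be reduced modulo `q - 1`.
* The third (`comap_parametrizationIdeal_le_iInf_ker`) follows by evaluating at `y = x`.
* For the last (`iInf_ker_lineHom_le_vanishingIdeal`), the coefficients of `φ_x f` are the values of
  the homogeneous components of `f`.

Parts (a) and (b) are then immediate, since the ideals `ker φ_x` are prime and contain no `t_i`.
For (c), the homomorphisms `φ_x` induce finitely many surjections from `S/I(X)` onto the principal
ideal domain `K[z]`, and these are jointly injective. Any Noetherian ring with such a family is
Cohen–Macaulay of dimension one: every prime ideal contains one of the kernels, which bounds the
dimension by that of `K[z]`, and by prime avoidance every maximal ideal contains an element outside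
all the kernels, which is a nonzerodivisor.
-/

namespace ToricSet

open MvPolynomial RingTheory.Sequence

/-! ### Rings with finitely many jointly injective surjections onto a domain -/

section CohenMacaulay

theorem exists_ker_le_of_isPrime {R D ι : Type*} [CommRing R] [CommRing D] [Finite ι]
    {φ : ι → R →+* D} (hinj : ⨅ i, RingHom.ker (φ i) = ⊥) (P : Ideal R) [hP : P.IsPrime] :
    ∃ i, RingHom.ker (φ i) ≤ P := by
  cases nonempty_fintype ι
  have h : Finset.univ.inf (fun i => RingHom.ker (φ i)) ≤ P := by
    rw [Finset.inf_univ_eq_iInf, hinj]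
    exact bot_le
  obtain ⟨i, -, hi⟩ := hP.inf_le'.1 h
  exact ⟨i, hi⟩

variable {R D ι : Type*} [CommRing R] [CommRing D] [IsDomain D]

/-- A prime ideal `P` that is not minimal properly contains a prime `Q ⊇ ker φ_i`, so it corresponds
to a nonzero prime ideal of the principal ideal domain `D`. -/
theorem krullDimLE_one_of_iInf_ker_eq_bot [IsPrincipalIdealRing D] [Finite ι] {φ : ι → R →+* D}
    (hsurj : ∀ i, Function.Surjective (φ i)) (hinj : ⨅ i, RingHom.ker (φ i) = ⊥) :
    Ring.KrullDimLE 1 R := by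
  refine .mk₁ fun P hP => or_iff_not_imp_left.2 fun hmin => ?_
  obtain ⟨Q, hQ, hQP⟩ : ∃ Q : Ideal R, Q.IsPrime ∧ Q < P := by
    by_contra! h
    exact hmin ⟨⟨hP, bot_le⟩, fun Q hQ hQP => (eq_or_lt_of_le hQP).elim (·.ge)
      fun hlt => (h Q hQ.1 hlt).elim⟩
  obtain ⟨i, hi⟩ := exists_ker_le_of_isPrime hinj Q
  have hcomap : (P.map (φ i)).comap (φ i) = P := by
    rw [Ideal.comap_map_of_surjective' _ (hsurj i), sup_eq_left.2 (hi.trans hQP.le)]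
  have hne : P.map (φ i) ≠ ⊥ := by
    intro h
    rw [Ideal.map_eq_bot_iff_le_ker] at h
    exact (h.trans hi).not_gt hQP
  have hprime : (P.map (φ i)).IsPrime :=
    Ideal.map_isPrime_of_surjective (hsurj i) (hi.trans hQP.le)
  have hmax := hprime.isMaximal_of_ne_bot hne
  rw [← hcomap]
  exact Ideal.comap_isMaximal_of_surjective (φ i) (hsurj i)

/-- By prime avoidance a maximal ideal has an element outside all the kernels, and such an element
is a nonzerodivisor since it is mapped to a nonzero element of the domain `D` by each `φ_i`. -/
theorem exists_mem_maximal_isSMulRegular (hD : ¬ IsField D) [Finite ι] {φ : ι → R →+* D}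
    (hsurj : ∀ i, Function.Surjective (φ i)) (hinj : ⨅ i, RingHom.ker (φ i) = ⊥)
    (m : Ideal R) [hm : m.IsMaximal] : ∃ r ∈ m, IsSMulRegular R r := by
  cases nonempty_fintype ι
  obtain ⟨r, hrm, hr⟩ : ∃ r ∈ m, ∀ i, φ i r ≠ 0 := by
    by_contra! h
    have hsub : (m : Set R) ⊆ ⋃ i ∈ ((Finset.univ : Finset ι) : Set ι),
        (RingHom.ker (φ i) : Set R) := by
      intro r hr
      obtain ⟨i, hi⟩ := h r hr
      simpa using ⟨i, hi⟩
    obtain ⟨i₀, -⟩ := h 0 m.zero_mem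
    -- The two indices at which prime avoidance does not require a prime ideal are not needed.
    obtain ⟨i, -, hi⟩ := (Ideal.subset_union_prime i₀ i₀
      fun i _ _ _ => RingHom.ker_isPrime (φ i)).1 hsub
    have hker : m = RingHom.ker (φ i) := hm.eq_of_le (RingHom.ker_ne_top _) hi
    have := hker ▸ hm
    exact hD (((RingHom.quotientKerEquivOfSurjective (hsurj i)).symm.toMulEquiv).isField
      ((Ideal.Quotient.maximal_ideal_iff_isField_quotient _).1 this))
  refine ⟨r, hrm, IsSMulRegular.of_right_eq_zero_of_smul fun x hx => ?_⟩
  have : x ∈ ⨅ i, RingHom.ker (φ i) := by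
    refine Ideal.mem_iInf.2 fun i => ?_
    have h := congrArg (φ i) hx
    rw [smul_eq_mul, map_mul, map_zero] at h
    exact (mul_eq_zero.1 h).resolve_left (hr i)
  rwa [hinj] at this

/-- The image of `r` is a regular sequence of length one in the localization, and the length of a
regular sequence is bounded by the dimension; so the depth and the dimension are both one. -/
theorem localDepth_eq_ringKrullDim_of_krullDimLE_one [IsNoetherianRing R] [Ring.KrullDimLE 1 R]
    (m : Ideal R) [m.IsMaximal] {r : R} (hrm : r ∈ m) (hr : IsSMulRegular R r) :
    ((localDepth (Localization.AtPrime m) : ℕ∞) : WithBot ℕ∞) =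
      ringKrullDim (Localization.AtPrime m) := by
  let A := Localization.AtPrime m
  have : IsNoetherianRing A := IsLocalization.isNoetherianRing m.primeCompl A inferInstance
  have hreg : IsRegular A [algebraMap R A r] :=
    ((isWeaklyRegular_singleton_iff R r).2 hr).isRegular_of_isLocalization_of_mem A m
      (by simpa using hrm)
  have hdim_le : ringKrullDim A ≤ 1 := by
    rw [IsLocalization.AtPrime.ringKrullDim_eq_height m A]
    exact Ideal.height_le_ringKrullDim_of_isPrime.trans (Ring.krullDimLE_iff.1 inferInstance)
  have hlen : ∀ rs : List A, IsRegular A rs → (rs.length : WithBot ℕ∞) ≤ ringKrullDim A := by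
    intro rs hrs
    have hnt : Nontrivial (A ⧸ Ideal.ofList rs) := by
      rw [Ideal.Quotient.nontrivial_iff]
      intro h
      exact hrs.top_ne_smul (by simp [h])
    rw [← ringKrullDim_add_length_eq_ringKrullDim_of_isRegular rs hrs]
    exact le_add_of_nonneg_left ringKrullDim_nonneg_of_nontrivial
  have hdim : ringKrullDim A = 1 := le_antisymm hdim_le (by simpa using hlen _ hreg)
  have hdepth : localDepth A = 1 := by
    apply le_antisymm
    · refine iSup₂_le fun rs hrs => ?_
      have := hlen rs hrs.2
      rw [hdim] at this
      exact_mod_cast this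
    · refine le_iSup₂_of_le [algebraMap R A r] ⟨?_, hreg⟩ (by simp)
      simpa using (IsLocalization.AtPrime.to_map_mem_maximal_iff A m r).2 hrm
  rw [hdepth, hdim]
  rfl

theorem isCohenMacaulay_of_iInf_ker_eq_bot [IsPrincipalIdealRing D] (hD : ¬ IsField D)
    [IsNoetherianRing R] [Finite ι] {φ : ι → R →+* D}
    (hsurj : ∀ i, Function.Surjective (φ i)) (hinj : ⨅ i, RingHom.ker (φ i) = ⊥) :
    IsCohenMacaulay R := by
  have := krullDimLE_one_of_iInf_ker_eq_bot hsurj hinj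
  refine ⟨inferInstance, fun m hm => ?_⟩
  obtain ⟨r, hrm, hr⟩ := exists_mem_maximal_isSMulRegular hD hsurj hinj m
  exact localDepth_eq_ringKrullDim_of_krullDimLE_one m hrm hr

theorem ringKrullDim_eq_one_of_iInf_ker_eq_bot [IsPrincipalIdealRing D] (hD : ¬ IsField D)
    [Finite ι] [Nonempty ι] {φ : ι → R →+* D}
    (hsurj : ∀ i, Function.Surjective (φ i)) (hinj : ⨅ i, RingHom.ker (φ i) = ⊥) :
    ringKrullDim R = 1 := by
  refine le_antisymm
    (Ring.krullDimLE_iff.1 (krullDimLE_one_of_iInf_ker_eq_bot hsurj hinj)) ?_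
  rw [← IsPrincipalIdealRing.ringKrullDim_eq_one D hD]
  exact ringKrullDim_le_of_surjective _ (hsurj (Classical.arbitrary ι))

end CohenMacaulay

/-! ### Restriction of polynomials to lines through the origin -/

section Lines

variable {K : Type*} [Field K] {s n : ℕ}

/-- The restriction of polynomials to the line spanned by `w`: the homomorphism
`K[t_1, …, t_s] → K[z]` with `t_i ↦ w_i z`. -/
noncomputable def lineHom (w : Fin s → K) : MvPolynomial (Fin s) K →ₐ[K] Polynomial K :=
  aeval fun i => Polynomial.C (w i) * Polynomial.X

/-- On the line spanned by `w`, a form `f` of degree `d` restricts to `f(w) z^d`. -/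
theorem coeff_lineHom (w : Fin s → K) (f : MvPolynomial (Fin s) K) (d : ℕ) :
    (lineHom w f).coeff d = eval w (homogeneousComponent d f) := by
  induction f using MvPolynomial.induction_on' with
  | add p q hp hq => simp [hp, hq]
  | monomial a c =>
    have h : lineHom w (monomial a c) =
        Polynomial.C (c * ∏ i, w i ^ a i) * Polynomial.X ^ a.degree := by
      rw [lineHom, aeval_monomial, Finsupp.prod_fintype _ _ fun _ => pow_zero _]
      simp only [mul_pow, Finset.prod_mul_distrib, Finset.prod_pow_eq_pow_sum, map_mul, map_prod,
        map_pow, Polynomial.algebraMap_eq, Finsupp.degree_eq_sum, mul_assoc]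
    rw [h, Polynomial.coeff_C_mul_X_pow,
      homogeneousComponent_of_mem (isHomogeneous_monomial c rfl)]
    split_ifs <;> simp [eval_monomial, Finsupp.prod_pow]

theorem lineHom_eq_zero_iff {w : Fin s → K} {f : MvPolynomial (Fin s) K} :
    lineHom w f = 0 ↔ ∀ d, eval w (homogeneousComponent d f) = 0 := by
  simp [Polynomial.ext_iff, coeff_lineHom]

theorem eval_smul_of_isHomogeneous {f : MvPolynomial (Fin s) K} {d : ℕ}
    (hf : f.IsHomogeneous d) (c : K) (w : Fin s → K) :
    eval (c • w) f = c ^ d * eval w f := by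
  rw [eval_eq', eval_eq', Finset.mul_sum]
  refine Finset.sum_congr rfl fun a ha => ?_
  have hd : a.degree = d := by
    rw [Finsupp.degree_eq_weight_one]
    exact hf (mem_support_iff.1 ha)
  simp only [Pi.smul_apply, smul_eq_mul, mul_pow, Finset.prod_mul_distrib,
    Finset.prod_pow_eq_pow_sum]
  rw [← Finsupp.degree_eq_sum, hd]
  ring

theorem toricPoint_apply_ne_zero (v : Fin s → Fin n → ℤ) (x : Fin n → Kˣ) (i : Fin s) :
    toricPoint v x i ≠ 0 :=
  Finset.prod_ne_zero_iff.2 fun j _ => zpow_ne_zero _ (x j).ne_zero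

theorem toricPoint_ne_zero (hs : 1 ≤ s) (v : Fin s → Fin n → ℤ) (x : Fin n → Kˣ) :
    toricPoint v x ≠ 0 :=
  fun h => toricPoint_apply_ne_zero v x ⟨0, hs⟩ (congrFun h _)

theorem iInf_ker_lineHom_le_vanishingIdeal (v : Fin s → Fin n → ℤ) :
    ⨅ x : Fin n → Kˣ, RingHom.ker (lineHom (toricPoint v x)) ≤
      vanishingIdeal (algebraicToricSet K v) := by
  intro f hf
  rw [← sum_homogeneousComponent f]
  refine Ideal.sum_mem _ fun d _ => Ideal.subset_span
    ⟨⟨d, homogeneousComponent_isHomogeneous d f⟩, ?_⟩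
  rintro P ⟨x, hx, rfl⟩ w hw hwx
  obtain ⟨c, rfl⟩ := (Projectivization.mk_eq_mk_iff' K _ _ hw hx).1 hwx
  have h : lineHom (toricPoint v x) f = 0 := (Ideal.mem_iInf.1 hf) x
  rw [eval_smul_of_isHomogeneous (homogeneousComponent_isHomogeneous d f),
    lineHom_eq_zero_iff.1 h d, mul_zero]

/-- Since `s ≥ 1`, the monomial `z = w_1⁻¹ (w_1 z)` is in the image. -/
theorem lineHom_surjective (hs : 1 ≤ s) {w : Fin s → K} (hw : ∀ i, w i ≠ 0) :
    Function.Surjective (lineHom w) := by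
  rw [← AlgHom.range_eq_top, eq_top_iff, ← Polynomial.adjoin_X, Algebra.adjoin_le_iff,
    Set.singleton_subset_iff]
  refine ⟨C (w ⟨0, hs⟩)⁻¹ * X ⟨0, hs⟩, ?_⟩
  simp [lineHom, ← mul_assoc, ← Polynomial.C_mul, hw]

end Lines

/-! ### The lattice of a toric set -/

section Lattice

variable {s n : ℕ}

/-- The lattice of the `c ∈ ℤ^s` with `c_1 + ⋯ + c_s = 0` and
`c_1 v_1 + ⋯ + c_s v_s ≡ 0 mod m`. -/
def relationLattice (m : ℕ) (v : Fin s → Fin n → ℕ) : AddSubgroup (Fin s → ℤ) where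
  carrier := {c | ∑ i, c i = 0 ∧
    ∀ j, (m : ℤ) ∣ ∑ i, (v i j : ℤ) * c i}
  zero_mem' := by simp
  add_mem' := by
    rintro c d ⟨hc, hc'⟩ ⟨hd, hd'⟩
    refine ⟨by simp [Finset.sum_add_distrib, hc, hd], fun j => ?_⟩
    simpa [mul_add, Finset.sum_add_distrib] using (hc' j).add (hd' j)
  neg_mem' := by
    rintro c ⟨hc, hc'⟩
    exact ⟨by simp [hc], fun j => by simpa using hc' j⟩

/-- The exponent of `y` in the monomial obtained from `t^a` by substituting `t_i = y^{v_i}`. -/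
def yExponent (v : Fin s → Fin n → ℕ) (a : Fin s →₀ ℕ) (j : Fin n) : ℕ :=
  ∑ i, v i j * a i

theorem sub_mem_relationLattice_iff {m : ℕ} {v : Fin s → Fin n → ℕ} {a b : Fin s →₀ ℕ} :
    (fun i => (a i : ℤ) - (b i : ℤ)) ∈ relationLattice m v ↔
      a.degree = b.degree ∧ ∀ j, yExponent v a j ≡ yExponent v b j [MOD m] := by
  refine and_congr ?_ (forall_congr' fun j => ?_)
  · rw [Finset.sum_sub_distrib, sub_eq_zero, Finsupp.degree_eq_sum, Finsupp.degree_eq_sum]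
    exact_mod_cast Iff.rfl
  · rw [Nat.ModEq.comm, Nat.modEq_iff_dvd]
    simp [yExponent, mul_sub, Finset.sum_sub_distrib]

theorem prod_prod_pow_pow_eq_prod_pow_yExponent {R : Type*} [CommMonoid R]
    (v : Fin s → Fin n → ℕ) (a : Fin s →₀ ℕ) (y : Fin n → R) :
    ∏ i, (∏ j, y j ^ v i j) ^ a i = ∏ j, y j ^ yExponent v a j := by
  simp only [yExponent, ← Finset.prod_pow_eq_pow_sum, ← Finset.prod_pow, ← pow_mul]
  exact Finset.prod_comm

variable {K : Type*} [Field K] [Fintype K]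

theorem latticeIdeal_relationLattice_le_comap (v : Fin s → Fin n → ℕ) :
    latticeIdeal K (relationLattice (Fintype.card K - 1) v) ≤
      (parametrizationIdeal K v).comap (inclusionB K s n) := by
  refine Ideal.span_le.2 ?_
  rintro _ ⟨a, b, hab, rfl⟩
  rw [sub_mem_relationLattice_iff] at hab
  set P := parametrizationIdeal K v
  let π := Ideal.Quotient.mk P
  let y : Fin n → MvPolynomial (BVar s n) K ⧸ P := fun j => π (X (.y j))
  have hy : ∀ j, y j ^ (Fintype.card K - 1) = 1 := by
    intro j
    have : π (X (.y j) ^ (Fintype.card K - 1) - 1) = 0 :=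
      Ideal.Quotient.eq_zero_iff_mem.2 (Ideal.subset_span (.inr ⟨j, rfl⟩))
    simpa [sub_eq_zero] using this
  have ht : ∀ i, π (X (.t i)) = (∏ j, y j ^ v i j) * π (X .z) := by
    intro i
    have : π (X (.t i) - (∏ j, X (.y j) ^ v i j) * X .z) = 0 :=
      Ideal.Quotient.eq_zero_iff_mem.2 (Ideal.subset_span (.inl ⟨i, rfl⟩))
    simpa [sub_eq_zero, y] using this
  have key : ∀ c : Fin s →₀ ℕ, π (inclusionB K s n (monomial c 1)) =
      (∏ j, y j ^ yExponent v c j) * π (X .z) ^ c.degree := by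
    intro c
    have : inclusionB K s n (monomial c 1) = ∏ i, X (.t i) ^ c i := by
      simp [inclusionB, monomial_eq, Finsupp.prod_pow]
    rw [this, map_prod, ← prod_prod_pow_pow_eq_prod_pow_yExponent, Finsupp.degree_eq_sum,
      ← Finset.prod_pow_eq_pow_sum, ← Finset.prod_mul_distrib]
    simp [ht, mul_pow]
  have : π (inclusionB K s n (monomial a 1)) = π (inclusionB K s n (monomial b 1)) := by
    rw [key, key, hab.1]
    congr 1
    refine Finset.prod_congr rfl fun j _ => ?_
    rw [pow_eq_pow_mod _ (hy j), hab.2 j, ← pow_eq_pow_mod _ (hy j)]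
  change inclusionB K s n (_ - _) ∈ P
  rw [map_sub]
  exact Ideal.Quotient.eq.1 this

theorem comap_parametrizationIdeal_le_iInf_ker (v : Fin s → Fin n → ℕ) :
    (parametrizationIdeal K v).comap (inclusionB K s n) ≤
      ⨅ x : Fin n → Kˣ, RingHom.ker (lineHom (toricPoint (fun i j => (v i j : ℤ)) x)) := by
  refine le_iInf fun x => ?_
  let w := toricPoint (fun i j => (v i j : ℤ)) x
  let ψ : MvPolynomial (BVar s n) K →ₐ[K] Polynomial K := aeval fun
    | .t i => Polynomial.C (w i) * Polynomial.X
    | .y j => Polynomial.C (x j : K)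
    | .z => Polynomial.X
  have hψ : ∀ f, ψ (inclusionB K s n f) = lineHom w f := by
    intro f
    simp only [ψ, inclusionB, lineHom, AlgHom.toRingHom_eq_coe, RingHom.coe_coe, aeval_rename]
    rfl
  have hle : parametrizationIdeal K v ≤ RingHom.ker ψ := by
    refine Ideal.span_le.2 (Set.union_subset ?_ ?_)
    · rintro _ ⟨i, rfl⟩
      simp [ψ, w, RingHom.mem_ker, toricPoint]
    · rintro _ ⟨j, rfl⟩
      simp [ψ, RingHom.mem_ker, ← Polynomial.C_pow,
        FiniteField.pow_card_sub_one_eq_one]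
  intro f hf
  exact (hψ f).symm.trans (hle hf)

/-- The character `x ↦ x^e` of the torus `(K^*)^n`, with values in `K`. -/
def torusCharacter (K : Type*) [Field K] (e : Fin n → ℕ) : (Fin n → Kˣ) →* K where
  toFun x := ∏ j, (x j : K) ^ e j
  map_one' := by simp
  map_mul' x y := by simp [mul_pow, Finset.prod_mul_distrib]

/-- The characters are compared at the point whose `j`-th coordinate is a generator of the cyclic
group `K^*` and whose other coordinates are `1`. -/
theorem modEq_of_torusCharacter_eq {e e' : Fin n → ℕ}
    (h : torusCharacter K e = torusCharacter K e') (j : Fin n) :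
    e j ≡ e' j [MOD Fintype.card K - 1] := by
  classical
  obtain ⟨g, hg⟩ := IsCyclic.exists_generator (α := Kˣ)
  have hval : ∀ d : Fin n → ℕ, torusCharacter K d (Pi.mulSingle j g) = (g : K) ^ d j := by
    intro d
    change ∏ k : Fin n, _ = _
    rw [Finset.prod_eq_single j]
    · simp
    · intro k _ hk
      simp [Pi.mulSingle_eq_of_ne hk]
    · simp
  have hpow : g ^ e j = g ^ e' j := by
    ext
    simpa [hval] using DFunLike.congr_fun h (Pi.mulSingle j g)
  rwa [pow_eq_pow_iff_modEq, orderOf_eq_card_of_forall_mem_zpowers hg, Nat.card_units,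
    Nat.card_eq_fintype_card] at hpow

/-- The relation `∑ c_a χ_a = 0` between characters given by a homogeneous `f = ∑ c_a t^a` vanishing
on `X` can be transported to `S / I(L)`, where the class of `t^a` depends only on `χ_a`. -/
theorem vanishingIdeal_le_latticeIdeal (hs : 1 ≤ s) (v : Fin s → Fin n → ℕ) :
    vanishingIdeal (algebraicToricSet K (fun i j => (v i j : ℤ))) ≤
      latticeIdeal K (relationLattice (Fintype.card K - 1) v) := by
  classical
  refine Ideal.span_le.2 ?_
  rintro f ⟨⟨d, hd⟩, hf⟩
  set J := latticeIdeal K (relationLattice (Fintype.card K - 1) v)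
  let χ : (Fin s →₀ ℕ) → ((Fin n → Kˣ) →* K) := fun a => torusCharacter K (yExponent v a)
  have hclass : ∀ a ∈ f.support, ∀ b ∈ f.support, χ a = χ b →
      Ideal.Quotient.mk J (monomial a 1) = Ideal.Quotient.mk J (monomial b 1) := by
    intro a ha b hb hab
    refine Ideal.Quotient.eq.2 (Ideal.subset_span ⟨a, b, ?_, rfl⟩)
    refine sub_mem_relationLattice_iff.2 ⟨?_, modEq_of_torusCharacter_eq hab⟩
    have h₁ := hd (mem_support_iff.1 ha)
    have h₂ := hd (mem_support_iff.1 hb)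
    rw [Finsupp.degree_eq_weight_one]
    exact h₁.trans h₂.symm
  -- The class of `t^a` modulo `J` as a function of the character of `t^a`.
  obtain ⟨g, hg⟩ : ∃ g : ((Fin n → Kˣ) →* K) → MvPolynomial (Fin s) K ⧸ J,
      ∀ a ∈ f.support, g (χ a) = Ideal.Quotient.mk J (monomial a 1) := by
    refine ⟨fun ξ => if h : ∃ a ∈ f.support, χ a = ξ then
      Ideal.Quotient.mk J (monomial h.choose 1) else 0, fun a ha => ?_⟩
    have h : ∃ b ∈ f.support, χ b = χ a := ⟨a, ha, rfl⟩
    refine (dif_pos h).trans ?_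
    exact hclass _ h.choose_spec.1 _ ha h.choose_spec.2
  -- The formal linear combination of characters attached to `f`.
  let F : ((Fin n → Kˣ) →* K) →₀ K := ∑ a ∈ f.support, Finsupp.single (χ a) (f.coeff a)
  have hF : F = 0 := by
    refine linearIndependent_iff.1 (linearIndependent_monoidHom (Fin n → Kˣ) K) F ?_
    ext x
    have hx := toricPoint_ne_zero hs (fun i j => (v i j : ℤ)) x
    have h := hf _ ⟨x, hx, rfl⟩ _ hx rfl
    rw [eval_eq'] at h
    simpa [F, χ, torusCharacter, ← prod_prod_pow_pow_eq_prod_pow_yExponent, toricPoint] using h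
  have hmk : Ideal.Quotient.mk J f = Finsupp.linearCombination K g F := by
    conv_lhs => rw [f.as_sum]
    simp only [F, map_sum, Finsupp.linearCombination_single]
    refine Finset.sum_congr rfl fun a ha => ?_
    rw [hg a ha, ← Ideal.Quotient.mkₐ_eq_mk K, ← map_smul, smul_monomial, smul_eq_mul, mul_one]
  rw [hF, map_zero] at hmk
  exact Ideal.Quotient.eq_zero_iff_mem.1 hmk

end Lattice

end ToricSet

theorem mainTheorem2 (K : Type*) [Field K] [Fintype K] (s n : ℕ) (hs : 1 ≤ s)
    (v : Fin s → Fin n → ℕ)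
    (I : Ideal (MvPolynomial (Fin s) K))
    (hI : I = ToricSet.vanishingIdeal
      (ToricSet.algebraicToricSet K (fun i j => (v i j : ℤ)))) :
    (I = (ToricSet.parametrizationIdeal K v).comap (ToricSet.inclusionB K s n) ∧
      ToricSet.IsBinomialIdeal I) ∧
    ((∀ i : Fin s, (MvPolynomial.X i : MvPolynomial (Fin s) K) ∉
        ToricSet.zeroDivisors (MvPolynomial (Fin s) K) (MvPolynomial (Fin s) K ⧸ I)) ∧
      I.IsRadical ∧ ToricSet.IsLatticeIdeal I) ∧
    (ToricSet.IsCohenMacaulay (MvPolynomial (Fin s) K ⧸ I) ∧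
      ringKrullDim (MvPolynomial (Fin s) K ⧸ I) = 1) := by
  let w : (Fin n → Kˣ) → Fin s → K := ToricSet.toricPoint fun i j => (v i j : ℤ)
  have hw : ∀ x i, w x i ≠ 0 := ToricSet.toricPoint_apply_ne_zero _
  have h₁ := hI.trans_le (ToricSet.vanishingIdeal_le_latticeIdeal hs v)
  have h₂ := ToricSet.latticeIdeal_relationLattice_le_comap (K := K) v
  have h₃ := ToricSet.comap_parametrizationIdeal_le_iInf_ker (K := K) v
  have h₄ := (ToricSet.iInf_ker_lineHom_le_vanishingIdeal (K := K)
    (fun (i : Fin s) (j : Fin n) => (v i j : ℤ))).trans hI.ge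
  have hlattice : I = ToricSet.latticeIdeal K (ToricSet.relationLattice (Fintype.card K - 1) v) :=
    le_antisymm h₁ (h₂.trans (h₃.trans h₄))
  have hker : I = ⨅ x, RingHom.ker (ToricSet.lineHom (w x)) :=
    le_antisymm (h₁.trans (h₂.trans h₃)) h₄
  let φ : (Fin n → Kˣ) → (MvPolynomial (Fin s) K ⧸ I) →+* Polynomial K := fun x =>
    Ideal.Quotient.lift I (ToricSet.lineHom (w x) : MvPolynomial (Fin s) K →+* Polynomial K)
      fun f hf => Ideal.mem_iInf.1 (hker ▸ hf) x
  have hsurj : ∀ x, Function.Surjective (φ x) := fun x =>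
    Ideal.Quotient.lift_surjective_of_surjective _ _ (ToricSet.lineHom_surjective hs (hw x))
  have hinj : ⨅ x, RingHom.ker (φ x) = ⊥ := by
    refine eq_bot_iff.2 fun f hf => ?_
    obtain ⟨f, rfl⟩ := Ideal.Quotient.mk_surjective f
    refine Ideal.Quotient.eq_zero_iff_mem.2 (hker.ge (Ideal.mem_iInf.2 fun x => ?_))
    exact Ideal.mem_iInf.1 hf x
  have hD : ¬ IsField (Polynomial K) := Polynomial.not_isField K
  refine ⟨⟨le_antisymm (h₁.trans h₂) (h₃.trans h₄), _, ?_, hlattice⟩, ⟨?_, ?_, _, hlattice⟩,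
    ToricSet.isCohenMacaulay_of_iInf_ker_eq_bot hD hsurj hinj,
    ToricSet.ringKrullDim_eq_one_of_iInf_ker_eq_bot hD hsurj hinj⟩
  · rintro _ ⟨a, b, -, rfl⟩
    exact ⟨a, b, rfl⟩
  · rintro i ⟨m, hm, him⟩
    refine hm ?_
    have : m ∈ ⨅ x, RingHom.ker (φ x) := by
      refine Ideal.mem_iInf.2 fun x => ?_
      obtain ⟨f, rfl⟩ := Ideal.Quotient.mk_surjective m
      have h : ToricSet.lineHom (w x) (MvPolynomial.X i * f) = 0 := congrArg (φ x) him
      rw [map_mul] at h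
      refine (mul_eq_zero.1 h).resolve_left ?_
      simp [ToricSet.lineHom, hw]
    rwa [hinj] at this
  · rw [hker]
    exact Ideal.isRadical_iInf _ fun x => (RingHom.ker_isPrime _).isRadical
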